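/- Let $d\ge 1$. A bounded open set $T\subset\mathbb{R}^d$ is a \emph{tile} if there is a set $T'\subset\mathbb{R}^d$ such that the translates $t'+T$, $t'\in T'$, are pairwise disjoint and cover $\mathbb{R}^d$ up to a set of Lebesgue measure zero. A bounded open set $T\subset\mathbb{R}^d$ is \emph{spectral} if there is a set $\Lambda\subset\mathbb{R}^d$ such that the functions $x\mapsto e^{2\pi i\langle\lambda,x\rangle}$, $\lambda\in\Lambda$, restricted to $T$, form a complete orthogonal system in $L^2(T)$. There exists a finite set $B\subset\mathbb{Z}^3$ such that the finite union of open unit cubes $T=\bigcup_{b\in B}\bigl(b+(0,1)^3\bigr)\subset\mathbb{R}^3$ is a tile but is not spectral. In particular, the ``tile $\rightarrow$ spectral'' direction of Fuglede's conjecture fails in dimension $3$. -/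

import Mathlib

open MeasureTheory

noncomputable section

namespace Fuglede

/-- The character `x ↦ exp (2πi ⟨ξ, x⟩)` of `ℝ^d`; the dual group is identified with `ℝ^d`. -/
def character {d : ℕ} (ξ x : EuclideanSpace ℝ (Fin d)) : ℂ :=
  Complex.exp (2 * Real.pi * Complex.I * (inner ℝ ξ x : ℝ))

/-- `Λ` is a spectrum of the (bounded open) set `T`: the characters with frequencies in `Λ`,
restricted to `T`, form a complete orthogonal system in `L²(T)`.  Completeness says that the
linear span of the classes of these functions is dense in `L²(T)`. -/
structure IsSpectrum {d : ℕ} (Λ T : Set (EuclideanSpace ℝ (Fin d))) : Prop where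
  orthogonal : ∀ ξ ∈ Λ, ∀ η ∈ Λ, ξ ≠ η →
    ∫ x in T, character ξ x * (starRingEnd ℂ) (character η x) = 0
  complete : (Submodule.span ℂ {f : Lp ℂ 2 (volume.restrict T) |
    ∃ ξ ∈ Λ, f =ᵐ[volume.restrict T] character ξ}).topologicalClosure = ⊤

/-- A (bounded open) set is spectral if it possesses a spectrum. -/
def IsSpectral {d : ℕ} (T : Set (EuclideanSpace ℝ (Fin d))) : Prop :=
  ∃ Λ : Set (EuclideanSpace ℝ (Fin d)), IsSpectrum Λ T

/-- `T'` is a tiling complement of `T`: the translates `t + T`, `t ∈ T'`, are pairwise disjoint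
and cover `ℝ^d` up to a set of Lebesgue measure zero. -/
structure IsTilingComplement {d : ℕ} (T' T : Set (EuclideanSpace ℝ (Fin d))) : Prop where
  disjoint : ∀ s ∈ T', ∀ t ∈ T', s ≠ t →
    Disjoint ((fun x => s + x) '' T) ((fun x => t + x) '' T)
  cover : volume (⋃ t ∈ T', (fun x => t + x) '' T)ᶜ = 0

/-- A tile is a bounded open set that possesses a tiling complement. -/
structure IsTile {d : ℕ} (T : Set (EuclideanSpace ℝ (Fin d))) : Prop where
  isOpen : IsOpen T
  isBounded : Bornology.IsBounded T
  exists_complement : ∃ T' : Set (EuclideanSpace ℝ (Fin d)), IsTilingComplement T' T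

/-- The open unit cube `b + (0,1)^d` with integer corner `b`. -/
def unitCube {d : ℕ} (b : Fin d → ℤ) : Set (EuclideanSpace ℝ (Fin d)) :=
  {x | ∀ i, (b i : ℝ) < x i ∧ x i < (b i : ℝ) + 1}

end Fuglede

end

/-! A divisibility obstruction separates tiling from spectrality. In `(ℤ/600)³`, where 600 = 8·3·25,
the set `layered` tiles with the six translates `shiftMod` (`existsUnique_sub_shiftMod_mem`), so it
has density 1/6. Residues modulo 25 are folded into nine layers, one for each difference `±freq j`
of the six-point set `packer` in `(ℤ/8)³`, and layer `j` is built to have a nonzero Fourier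
coefficient at `freq j`. A positivity argument prevents the layers from cancelling each other, so
the transform vanishes at no difference of `packer` (`layeredTransform_ne_zero`). Hence, if all
differences within a set `I` of frequencies modulo 8 are zeros of the transform, the translates of
`packer` by `I` are disjoint: 6|I| ≤ 512. As 6 does not divide 512, |I| ≤ 85 < 512/6
(`card_le_of_layeredTransform_eq_zero`).

To reach ℝ³, `layered` is repeated over L³ periods and thickened to unit cubes. The result T still
tiles, and its transform is `layeredSum` times Dirichlet kernels times `cubeFactor`. For L large,
nonvanishing persists near the relevant points of (1/8)ℤ³, so every translate of the comb V =
`combSet (1 / (600 * L))` contains at most 85 points of a spectrum. But Parseval integrated over V,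
combined with Plancherel, gives |T||V| ≤ 85 (`IsSpectrum.volume_mul_volume_le`), whereas |T||V| =
512/6. -/

noncomputable section

namespace Fuglede

open scoped ENNReal FourierTransform SchwartzMap

/-! ### Characters, the transform of an indicator function, and Plancherel -/

section Characters

variable {d : ℕ}

theorem continuous_character (ξ : EuclideanSpace ℝ (Fin d)) : Continuous (character ξ) := by
  unfold character; fun_prop

theorem norm_character (ξ x : EuclideanSpace ℝ (Fin d)) : ‖character ξ x‖ = 1 := by
  have h : (2 * Real.pi * Complex.I * (inner ℝ ξ x : ℝ) : ℂ)
      = ((2 * Real.pi * inner ℝ ξ x : ℝ) : ℂ) * Complex.I := by push_cast; ring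
  rw [character, h, Complex.norm_exp_ofReal_mul_I]

theorem character_add_left (ξ η x : EuclideanSpace ℝ (Fin d)) :
    character (ξ + η) x = character ξ x * character η x := by
  rw [character, character, character, ← Complex.exp_add, inner_add_left]
  push_cast; ring_nf

theorem conj_character (ξ x : EuclideanSpace ℝ (Fin d)) :
    (starRingEnd ℂ) (character ξ x) = character (-ξ) x := by
  rw [character, character, ← Complex.exp_conj]
  simp [Complex.conj_ofReal, Complex.conj_ofNat]

theorem character_mul_conj (ξ η x : EuclideanSpace ℝ (Fin d)) :
    character ξ x * (starRingEnd ℂ) (character η x) = character (ξ - η) x := by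
  rw [conj_character, ← character_add_left, sub_eq_add_neg]

/-- The (inverse) Fourier transform of the indicator function of `T`. -/
def setTransform (T : Set (EuclideanSpace ℝ (Fin d))) (ξ : EuclideanSpace ℝ (Fin d)) : ℂ :=
  ∫ x in T, character ξ x

variable {T : Set (EuclideanSpace ℝ (Fin d))}

theorem continuous_setTransform (hT : volume T ≠ ∞) : Continuous (setTransform T) := by
  have : IsFiniteMeasure (volume.restrict T) := ⟨by simpa using hT.lt_top⟩
  refine continuous_of_dominated (bound := fun _ => 1) ?_ ?_ (integrable_const _) ?_
  · exact fun ξ => (continuous_character ξ).aestronglyMeasurable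
  · exact fun ξ => Filter.Eventually.of_forall fun x => (norm_character ξ x).le
  · refine Filter.Eventually.of_forall fun x => ?_
    unfold character; fun_prop

theorem setTransform_eq_fourier (hT : MeasurableSet T) (ξ : EuclideanSpace ℝ (Fin d)) :
    setTransform T ξ = 𝓕 (T.indicator fun _ => (1 : ℂ)) (-ξ) := by
  rw [Real.fourier_eq', setTransform, ← integral_indicator hT]
  refine integral_congr_ae (Filter.Eventually.of_forall fun x => ?_)
  by_cases hx : x ∈ T
  · simp only [Set.indicator_of_mem hx, character, smul_eq_mul, mul_one]
    congr 1
    rw [inner_neg_right, real_inner_comm]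
    push_cast; ring
  · simp [hx]

/-- **Plancherel's theorem**: the Fourier integral of a function in `L¹ ∩ L²` represents its
`L²` Fourier transform. -/
theorem fourier_toLp_ae_eq {f : EuclideanSpace ℝ (Fin d) → ℂ} (h1 : Integrable f)
    (h2 : MemLp f 2) : (𝓕 (h2.toLp f) : Lp ℂ 2 volume) =ᵐ[volume] 𝓕 f := by
  set F : Lp ℂ 2 (volume : Measure (EuclideanSpace ℝ (Fin d))) := 𝓕 (h2.toLp f) with hF
  have hcont : Continuous (𝓕 f) :=
    VectorFourier.fourierIntegral_continuous Real.continuous_fourierChar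
      continuous_inner h1
  -- Both sides are locally integrable, so it suffices to pair them with smooth compactly supported
  -- functions. These are Schwartz, which gives access to the distributional Fourier transform.
  refine ae_eq_of_integral_contDiff_smul_eq ?_ hcont.locallyIntegrable ?_
  · exact (Lp.memLp F).locallyIntegrable (by norm_num)
  intro g hg hgs
  have hgc : HasCompactSupport fun x => (g x : ℂ) := hgs.comp_left (g := fun r : ℝ => (r : ℂ)) rfl
  have hgd : ContDiff ℝ (⊤ : ℕ∞) fun x => (g x : ℂ) :=
    Complex.ofRealCLM.contDiff.comp hg
  set φ : 𝓢(EuclideanSpace ℝ (Fin d), ℂ) := hgc.toSchwartzMap hgd with hφ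
  have hφa : ∀ x, φ x = (g x : ℂ) := fun x => rfl
  have key := congrArg (fun u => u φ) (Lp.fourier_toTemperedDistribution_eq (h2.toLp f))
  simp only [TemperedDistribution.fourier_apply, Lp.toTemperedDistribution_apply] at key
  have e1 : ∫ x, g x • F x = ∫ x, φ x • F x := by
    simp [hφa]
  rw [e1, ← key]
  have e2 : ∫ x, (𝓕 φ) x • (h2.toLp f) x = ∫ x, (𝓕 φ) x • f x := by
    refine integral_congr_ae ?_
    filter_upwards [h2.coeFn_toLp] with x hx
    rw [hx]
  rw [e2]
  -- The multiplication formula ∫ φ̂ f = ∫ φ f̂ moves the transform back onto `f`.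
  have e3 := VectorFourier.integral_bilin_fourierIntegral_eq_flip (ContinuousLinearMap.mul ℂ ℂ)
    (L := innerₗ (EuclideanSpace ℝ (Fin d))) (μ := volume) (ν := volume)
    Real.continuous_fourierChar continuous_inner φ.integrable h1
  have e4 : ∀ x, g x • 𝓕 f x = φ x * 𝓕 f x := fun x => by simp [hφa]
  simp only [e4, smul_eq_mul]
  refine e3.trans ?_
  simp only [flip_innerₗ]
  rfl

/-- Plancherel for the indicator of `T`; the opposite sign convention of `character` is absorbed by
ξ ↦ -ξ. -/
theorem lintegral_enorm_setTransform_sq (hT : MeasurableSet T) (hv : volume T ≠ ∞) :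
    ∫⁻ ξ, ‖setTransform T ξ‖ₑ ^ 2 = volume T := by
  have h1 : Integrable (T.indicator fun _ => (1 : ℂ)) :=
    (integrable_indicator_iff hT).2 (integrableOn_const hv)
  have h2 : MemLp (T.indicator fun _ => (1 : ℂ)) 2 volume :=
    memLp_indicator_const 2 hT 1 (Or.inr hv)
  have h3 := congrArg ENNReal.ofReal (Lp.norm_fourier_eq (h2.toLp _))
  rw [ofReal_norm, ofReal_norm, Lp.enorm_def, Lp.enorm_def,
    eLpNorm_congr_ae (fourier_toLp_ae_eq h1 h2), eLpNorm_congr_ae h2.coeFn_toLp] at h3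
  have h4 := congrArg (· ^ 2) h3
  have h5 : ∀ f : EuclideanSpace ℝ (Fin d) → ℂ, eLpNorm f 2 volume ^ 2 = ∫⁻ x, ‖f x‖ₑ ^ 2 := by
    intro f
    rw [eLpNorm_eq_lintegral_rpow_enorm_toReal (by norm_num) (by norm_num)]
    rw [← ENNReal.rpow_natCast, ← ENNReal.rpow_mul]
    simp
  simp only [h5] at h4
  calc ∫⁻ ξ, ‖setTransform T ξ‖ₑ ^ 2
      = ∫⁻ ξ, ‖𝓕 (T.indicator fun _ => (1 : ℂ)) (-ξ)‖ₑ ^ 2 := by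
        simp_rw [setTransform_eq_fourier hT]
    _ = ∫⁻ ξ, ‖𝓕 (T.indicator fun _ => (1 : ℂ)) ξ‖ₑ ^ 2 :=
        lintegral_neg_eq_self (μ := volume)
          fun ξ => ‖𝓕 (T.indicator fun _ => (1 : ℂ)) ξ‖ₑ ^ 2
    _ = ∫⁻ x, T.indicator 1 x := by
        rw [h4]
        refine lintegral_congr fun x => ?_
        by_cases hx : x ∈ T <;> simp [hx]
    _ = volume T := by rw [lintegral_indicator_one hT]

end Characters
end Fuglede

end

noncomputable section

namespace Fuglede

open scoped ENNReal

/-! ### Parseval for a spectrum and the resulting density bound -/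

section Density

variable {d : ℕ} {T Λ : Set (EuclideanSpace ℝ (Fin d))}

theorem memLp_character (hv : volume T ≠ ∞) (ξ : EuclideanSpace ℝ (Fin d)) :
    MemLp (character ξ) 2 (volume.restrict T) := by
  have : IsFiniteMeasure (volume.restrict T) := ⟨by simpa using hv.lt_top⟩
  exact MemLp.of_bound (continuous_character ξ).aestronglyMeasurable 1
    (Filter.Eventually.of_forall fun x => (norm_character ξ x).le)

/-- The class of a character in `L²(T)`. -/
def characterLp (hv : volume T ≠ ∞) (ξ : EuclideanSpace ℝ (Fin d)) :
    Lp ℂ 2 (volume.restrict T) :=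
  (memLp_character hv ξ).toLp _

theorem inner_characterLp (hv : volume T ≠ ∞) (ξ η : EuclideanSpace ℝ (Fin d)) :
    inner ℂ (characterLp hv ξ) (characterLp hv η) = setTransform T (η - ξ) := by
  rw [L2.inner_def, setTransform]
  refine integral_congr_ae ?_
  filter_upwards [(memLp_character hv ξ).coeFn_toLp, (memLp_character hv η).coeFn_toLp]
    with x h1 h2
  rw [characterLp, characterLp, h1, h2, ← character_mul_conj]
  rfl

theorem IsSpectrum.setTransform_eq_zero (h : IsSpectrum Λ T)
    {ξ η : EuclideanSpace ℝ (Fin d)} (hξ : ξ ∈ Λ) (hη : η ∈ Λ) (hne : ξ ≠ η) :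
    setTransform T (ξ - η) = 0 := by
  have := h.orthogonal ξ hξ η hη hne
  simp only [character_mul_conj] at this
  exact this

theorem setTransform_zero : setTransform T 0 = (volume.real T : ℂ) := by
  simp [setTransform, character]

theorem IsSpectrum.orthonormal (h : IsSpectrum Λ T) (hv : volume T ≠ ∞) (h0 : volume T ≠ 0) :
    Orthonormal ℂ fun ξ : Λ =>
      (((√(volume.real T))⁻¹ : ℝ) : ℂ) • characterLp hv (ξ : EuclideanSpace ℝ (Fin d)) := by
  have hpos : 0 < volume.real T := ENNReal.toReal_pos h0 hv
  classical
  rw [orthonormal_iff_ite]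
  intro ξ η
  rw [inner_smul_left, inner_smul_right, inner_characterLp]
  split_ifs with he
  · subst he
    rw [sub_self, setTransform_zero, Complex.conj_ofReal, ← Complex.ofReal_mul,
      ← Complex.ofReal_mul, ← Complex.ofReal_one]
    congr 1
    rw [← mul_assoc, ← mul_inv, Real.mul_self_sqrt hpos.le, inv_mul_cancel₀ hpos.ne']
  · rw [h.setTransform_eq_zero η.2 ξ.2 fun h' => he (Subtype.ext h'.symm)]
    simp

theorem one_le_dist_of_orthogonal {E : Type*} [NormedAddCommGroup E] [InnerProductSpace ℂ E]
    {a b : E} (ha : ‖a‖ = 1) (hb : ‖b‖ = 1) (hab : inner ℂ a b = 0) : 1 ≤ dist a b := by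
  have h2 := @norm_sub_sq ℂ _ _ _ _ a b
  rw [ha, hb, hab] at h2
  rw [dist_eq_norm]
  norm_num at h2
  nlinarith [norm_nonneg (a - b)]

/-- Balls of radius 1/2 about orthonormal vectors are disjoint, and L² is separable. Countability is
what later permits exchanging the sum over `Λ` with an integral. -/
theorem IsSpectrum.countable (h : IsSpectrum Λ T) (hv : volume T ≠ ∞) (h0 : volume T ≠ 0) :
    Λ.Countable := by
  have ho := h.orthonormal hv h0
  have hd : Set.PairwiseDisjoint (Set.univ : Set Λ) fun ξ =>
      Metric.ball ((((√(volume.real T))⁻¹ : ℝ) : ℂ) •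
        characterLp hv (ξ : EuclideanSpace ℝ (Fin d))) (1 / 2) := by
    intro ξ _ η _ hne
    refine Metric.ball_disjoint_ball ?_
    have h1 : (1 / 2 : ℝ) + 1 / 2 = 1 := by norm_num
    rw [h1]
    exact one_le_dist_of_orthogonal (ho.1 ξ) (ho.1 η) (ho.2 hne)
  have : Fact ((2 : ℝ≥0∞) ≠ ∞) := ⟨by norm_num⟩
  have := hd.countable_of_isOpen (fun _ _ => Metric.isOpen_ball)
    (fun _ _ => Metric.nonempty_ball.2 (by norm_num))
  exact Set.countable_coe_iff.1 (Set.countable_univ_iff.1 this)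

/-- **Parseval's identity** for a spectrum, tested on characters. -/
theorem IsSpectrum.tsum_setTransform_sq (h : IsSpectrum Λ T) (hv : volume T ≠ ∞)
    (h0 : volume T ≠ 0) (ξ : EuclideanSpace ℝ (Fin d)) :
    ∑' η : Λ, ‖setTransform T (ξ - η)‖ₑ ^ 2 = volume T ^ 2 := by
  have hpos : 0 < volume.real T := ENNReal.toReal_pos h0 hv
  have ho := h.orthonormal hv h0
  have hc : (((√(volume.real T))⁻¹ : ℝ) : ℂ) ≠ 0 := by
    simpa using (Real.sqrt_pos.2 hpos).ne'
  have hsp : ⊤ ≤ (Submodule.span ℂ (Set.range fun ξ : Λ =>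
      (((√(volume.real T))⁻¹ : ℝ) : ℂ) •
        characterLp hv (ξ : EuclideanSpace ℝ (Fin d)))).topologicalClosure := by
    rw [← h.complete]
    refine Submodule.topologicalClosure_mono (Submodule.span_le.2 ?_)
    rintro f ⟨η, hη, hf⟩
    have hfe : f = characterLp hv η :=
      Lp.ext (hf.trans (memLp_character hv η).coeFn_toLp.symm)
    have := Submodule.smul_mem (Submodule.span ℂ (Set.range fun ξ : Λ =>
      (((√(volume.real T))⁻¹ : ℝ) : ℂ) • characterLp hv (ξ : EuclideanSpace ℝ (Fin d))))
      (((√(volume.real T))⁻¹ : ℝ) : ℂ)⁻¹ (Submodule.subset_span ⟨⟨η, hη⟩, rfl⟩)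
    rw [smul_smul, inv_mul_cancel₀ hc, one_smul] at this
    rw [hfe]; exact this
  set b := HilbertBasis.mk ho hsp with hb
  have hs := b.hasSum_inner_mul_inner (characterLp hv ξ) (characterLp hv ξ)
  rw [inner_characterLp, sub_self, setTransform_zero] at hs
  have hterm : ∀ η : Λ, inner ℂ (characterLp hv ξ) (b η) * inner ℂ (b η) (characterLp hv ξ)
      = (((volume.real T)⁻¹ * ‖setTransform T (ξ - η)‖ ^ 2 : ℝ) : ℂ) := by
    intro η
    rw [← inner_conj_symm, hb, HilbertBasis.coe_mk, inner_smul_left, inner_characterLp,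
      ← Complex.normSq_eq_conj_mul_self, Complex.normSq_mul]
    congr 1
    rw [Complex.normSq_eq_norm_sq, Complex.normSq_eq_norm_sq, Complex.conj_ofReal,
      Complex.norm_real, Real.norm_eq_abs, sq_abs, inv_pow, Real.sq_sqrt hpos.le]
  simp only [hterm] at hs
  have hs2 := (Complex.hasSum_ofReal.1 hs).mul_left (volume.real T)
  simp only [← mul_assoc, mul_inv_cancel₀ hpos.ne', one_mul] at hs2
  have hs3 := hs2.tsum_eq
  have : volume T ^ 2 = ENNReal.ofReal (volume.real T * volume.real T) := by
    rw [ENNReal.ofReal_mul hpos.le, measureReal_def, ENNReal.ofReal_toReal hv, sq]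
  rw [this, ← hs3, ENNReal.ofReal_tsum_of_nonneg (fun _ => by positivity) hs2.summable]
  refine tsum_congr fun η => ?_
  rw [ENNReal.ofReal_pow (norm_nonneg _), ofReal_norm]

/-- If every translate of `V` contains at most `c` points of a spectrum of `T`, then
`|T| |V| ≤ c`. -/
theorem IsSpectrum.volume_mul_volume_le (h : IsSpectrum Λ T) (hT : MeasurableSet T)
    (hv : volume T ≠ ∞) (h0 : volume T ≠ 0) {V : Set (EuclideanSpace ℝ (Fin d))}
    (hV : MeasurableSet V) {c : ℕ}
    (hc : ∀ u, {ξ ∈ Λ | u + ξ ∈ V}.encard ≤ c) : volume T * volume V ≤ c := by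
  have : Countable Λ := (h.countable hv h0).to_subtype
  have hmeas : Measurable fun ξ => ‖setTransform T ξ‖ₑ ^ 2 :=
    (continuous_setTransform hv).enorm.measurable.pow_const 2
  -- Integrate Parseval over `V` and translate each term by `η`: the weight of ‖setTransform T u‖²
  -- becomes the number of `η` with u + η in `V`, at most `c`. Plancherel evaluates what remains.
  have key : volume T ^ 2 * volume V ≤ volume T * c := by
    calc volume T ^ 2 * volume V
        = ∫⁻ ξ in V, ∑' η : Λ, ‖setTransform T (ξ - η)‖ₑ ^ 2 := by
          simp_rw [h.tsum_setTransform_sq hv h0]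
          rw [setLIntegral_const]
      _ = ∑' η : Λ, ∫⁻ ξ in V, ‖setTransform T (ξ - η)‖ₑ ^ 2 := by
          refine lintegral_tsum fun η => ?_
          exact (hmeas.comp (measurable_id.sub_const _)).aemeasurable
      _ = ∑' η : Λ, ∫⁻ u, V.indicator 1 (u + η) * ‖setTransform T u‖ₑ ^ 2 := by
          refine tsum_congr fun η => ?_
          rw [← lintegral_indicator hV, ← lintegral_add_right_eq_self _ (η : EuclideanSpace ℝ (Fin d))]
          refine lintegral_congr fun u => ?_
          by_cases hu : u + (η : EuclideanSpace ℝ (Fin d)) ∈ V <;> simp [hu]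
      _ = ∫⁻ u, ∑' η : Λ, V.indicator 1 (u + η) * ‖setTransform T u‖ₑ ^ 2 := by
          refine (lintegral_tsum fun η => ?_).symm
          refine (Measurable.mul ?_ hmeas).aemeasurable
          exact (measurable_one.indicator hV).comp (measurable_id.add_const _)
      _ ≤ ∫⁻ u, c * ‖setTransform T u‖ₑ ^ 2 := by
          refine lintegral_mono fun u => ?_
          simp only
          rw [ENNReal.tsum_mul_right]
          gcongr
          have e1 : ∀ η : Λ, V.indicator (1 : EuclideanSpace ℝ (Fin d) → ℝ≥0∞) (u + η)
              = Set.indicator {η : Λ | u + (η : EuclideanSpace ℝ (Fin d)) ∈ V} (fun _ => 1) η := by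
            intro η
            by_cases hu : u + (η : EuclideanSpace ℝ (Fin d)) ∈ V <;> simp [hu]
          simp_rw [e1]
          rw [← tsum_subtype, ENNReal.tsum_set_one]
          have e2 : {η : Λ | u + (η : EuclideanSpace ℝ (Fin d)) ∈ V}.encard
              = {ξ ∈ Λ | u + ξ ∈ V}.encard := by
            rw [← Subtype.val_injective.encard_image]
            congr 1
            ext ξ
            simp [and_comm]
          rw [e2]
          exact_mod_cast hc u
      _ = volume T * c := by
          rw [lintegral_const_mul _ hmeas, lintegral_enorm_setTransform_sq hT hv, mul_comm]
  rw [sq, mul_assoc] at key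
  exact (ENNReal.mul_le_mul_iff_right h0 hv).1 key

end Density
end Fuglede

end

noncomputable section

namespace Fuglede

open scoped ENNReal

/-! ### Unions of unit cubes: tiling and transform -/

section Cubes

variable {d : ℕ}

/-- An integer vector, seen as a point of Euclidean space. -/
def intVec (b : Fin d → ℤ) : EuclideanSpace ℝ (Fin d) := WithLp.toLp 2 fun i => (b i : ℝ)

@[simp]
theorem intVec_apply (b : Fin d → ℤ) (i : Fin d) : intVec b i = b i := rfl

theorem unitCube_eq_preimage (b : Fin d → ℤ) :
    unitCube b = (WithLp.ofLp : EuclideanSpace ℝ (Fin d) → Fin d → ℝ) ⁻¹'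
      Set.univ.pi fun i => Set.Ioo (b i : ℝ) (b i + 1) := by
  ext x; simp [unitCube]

theorem isOpen_unitCube (b : Fin d → ℤ) : IsOpen (unitCube b) := by
  rw [unitCube_eq_preimage]
  exact (isOpen_set_pi Set.finite_univ fun _ _ => isOpen_Ioo).preimage
    (PiLp.continuous_ofLp 2 _)

theorem isBounded_unitCube (b : Fin d → ℤ) : Bornology.IsBounded (unitCube b) := by
  rw [unitCube_eq_preimage]
  exact (PiLp.antilipschitzWith_ofLp 2 fun _ : Fin d => ℝ).isBounded_preimage
    (Bornology.IsBounded.pi fun _ => Metric.isBounded_Ioo _ _)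

theorem volume_unitCube (b : Fin d → ℤ) : volume (unitCube b) = 1 := by
  rw [unitCube_eq_preimage, (PiLp.volume_preserving_ofLp (Fin d)).measure_preimage
    (MeasurableSet.univ_pi fun _ => measurableSet_Ioo).nullMeasurableSet, volume_pi_pi]
  simp

theorem mem_unitCube_floor {b : Fin d → ℤ} {x : EuclideanSpace ℝ (Fin d)} (hx : x ∈ unitCube b)
    (i : Fin d) : ⌊x i⌋ = b i :=
  Int.floor_eq_iff.2 ⟨(hx i).1.le, (hx i).2⟩

theorem disjoint_unitCube {a b : Fin d → ℤ} (h : a ≠ b) : Disjoint (unitCube a) (unitCube b) := by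
  refine Set.disjoint_left.2 fun x ha hb => h (funext fun i => ?_)
  rw [← mem_unitCube_floor ha i, mem_unitCube_floor hb i]

theorem intVec_add_mem_unitCube {s a : Fin d → ℤ} {x : EuclideanSpace ℝ (Fin d)}
    (hx : x ∈ unitCube a) : intVec s + x ∈ unitCube (s + a) := by
  intro i
  have := hx i
  simp only [PiLp.add_apply, intVec_apply, Pi.add_apply]
  push_cast
  constructor <;> linarith

/-- The points with an integer coordinate form a null set. -/
theorem volume_exists_intCoord :
    volume {x : EuclideanSpace ℝ (Fin d) | ∃ i, ∃ n : ℤ, x i = n} = 0 := by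
  have : {x : EuclideanSpace ℝ (Fin d) | ∃ i, ∃ n : ℤ, x i = n}
      = ⋃ i, ⋃ n : ℤ, {x : EuclideanSpace ℝ (Fin d) | x i = n} := by
    ext x; simp
  rw [this, measure_iUnion_null_iff]
  intro i
  rw [measure_iUnion_null_iff]
  intro n
  have h1 : {x : EuclideanSpace ℝ (Fin d) | x i = n}
      = (WithLp.ofLp : EuclideanSpace ℝ (Fin d) → Fin d → ℝ) ⁻¹'
        (Function.eval i ⁻¹' {(n : ℝ)}) := by
    ext x; simp
  rw [h1, (PiLp.volume_preserving_ofLp (Fin d)).measure_preimage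
    ((measurable_pi_apply i) (measurableSet_singleton _)).nullMeasurableSet]
  exact Measure.pi_eval_preimage_null _ (by simp)

section Union

variable (A : Finset (Fin d → ℤ))

theorem isOpen_iUnion_unitCube : IsOpen (⋃ b ∈ A, unitCube b) :=
  isOpen_biUnion fun b _ => isOpen_unitCube b

theorem pairwiseDisjoint_unitCube :
    Set.PairwiseDisjoint (A : Set (Fin d → ℤ)) unitCube :=
  fun _ _ _ _ h => disjoint_unitCube h

theorem volume_iUnion_unitCube : volume (⋃ b ∈ A, unitCube b) = A.card := by
  rw [measure_biUnion_finset (pairwiseDisjoint_unitCube A)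
    fun b _ => (isOpen_unitCube b).measurableSet]
  simp [volume_unitCube]

variable {A}

/-- An integer tiling complement of `A` turns the union of the unit cubes at `A` into a tile. -/
theorem isTile_iUnion_unitCube {T' : Set (Fin d → ℤ)}
    (hcov : ∀ y : Fin d → ℤ, ∃ t ∈ T', ∃ a ∈ A, t + a = y)
    (huniq : ∀ s ∈ T', ∀ t ∈ T', ∀ a ∈ A, ∀ b ∈ A, s + a = t + b → s = t) :
    IsTile (⋃ b ∈ A, unitCube b) := by
  refine ⟨isOpen_iUnion_unitCube A, ?_, intVec '' T', ?_, ?_⟩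
  · exact (Bornology.isBounded_biUnion_finset A).2 fun b _ => isBounded_unitCube b
  · rintro _ ⟨s, hs, rfl⟩ _ ⟨t, ht, rfl⟩ hne
    refine Set.disjoint_left.2 ?_
    rintro _ ⟨x, hx, rfl⟩ ⟨y, hy, hxy⟩
    simp only [Set.mem_iUnion, exists_prop] at hx hy
    obtain ⟨a, ha, hxa⟩ := hx
    obtain ⟨b, hb, hyb⟩ := hy
    refine hne (congrArg intVec (huniq s hs t ht a ha b hb ?_))
    funext i
    have h1 := mem_unitCube_floor (intVec_add_mem_unitCube (s := s) hxa) i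
    have h2 := mem_unitCube_floor (intVec_add_mem_unitCube (s := t) hyb) i
    simp only at hxy
    rw [← h1, ← h2, hxy]
  · refine measure_mono_null ?_ (volume_exists_intCoord (d := d))
    intro x hx
    by_contra hcon
    simp only [Set.mem_ofPred_eq, not_exists] at hcon
    -- A point without integer coordinates lies strictly inside the cube whose corner is its floor.
    obtain ⟨t, ht, a, ha, hta⟩ := hcov fun i => ⌊x i⌋
    refine hx ?_
    simp only [Set.mem_iUnion, exists_prop]
    refine ⟨intVec t, ⟨t, ht, rfl⟩, x - intVec t, ?_, by simp⟩
    simp only [Set.mem_iUnion, exists_prop]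
    refine ⟨a, ha, fun i => ?_⟩
    have h1 : ((t i + a i : ℤ) : ℝ) = ⌊x i⌋ := by exact_mod_cast congrFun hta i
    push_cast at h1
    have h2 := (Int.floor_le (x i)).lt_of_ne fun h => hcon i _ h.symm
    have h3 := Int.lt_floor_add_one (x i)
    simp only [PiLp.sub_apply, intVec_apply]
    constructor <;> linarith

end Union

/-- The Fourier factor of the unit cube at the origin. -/
def cubeFactor (ξ : EuclideanSpace ℝ (Fin d)) : ℂ :=
  ∏ i, ∫ t in (0 : ℝ)..1, Complex.exp (2 * Real.pi * Complex.I * ξ i * t)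

theorem character_eq_prod (ξ x : EuclideanSpace ℝ (Fin d)) :
    character ξ x = ∏ i, Complex.exp (2 * Real.pi * Complex.I * ξ i * x i) := by
  rw [character, ← Complex.exp_sum, PiLp.inner_apply]
  congr 1
  push_cast
  rw [Finset.mul_sum]
  refine Finset.sum_congr rfl fun i _ => ?_
  simp only [RCLike.inner_apply, conj_trivial]
  push_cast; ring

theorem setTransform_unitCube (b : Fin d → ℤ) (ξ : EuclideanSpace ℝ (Fin d)) :
    setTransform (unitCube b) ξ = character ξ (intVec b) * cubeFactor ξ := by
  have h1 : setTransform (unitCube b) ξ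
      = ∫ x in Set.univ.pi fun i => Set.Ioo (b i : ℝ) (b i + 1),
        ∏ i, Complex.exp (2 * Real.pi * Complex.I * ξ i * x i) := by
    rw [setTransform, unitCube_eq_preimage]
    simp_rw [character_eq_prod]
    exact (PiLp.volume_preserving_ofLp (Fin d)).setIntegral_preimage_emb
      (MeasurableEquiv.toLp 2 (Fin d → ℝ)).symm.measurableEmbedding
      (fun x => ∏ i, Complex.exp (2 * Real.pi * Complex.I * ξ i * x i)) _
  rw [h1, volume_pi, Measure.restrict_pi_pi,
    integral_fintype_prod_eq_prod
      (fun i (t : ℝ) => Complex.exp (2 * Real.pi * Complex.I * ξ i * t)),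
    character_eq_prod, cubeFactor, ← Finset.prod_mul_distrib]
  refine Finset.prod_congr rfl fun i _ => ?_
  rw [← integral_Ioc_eq_integral_Ioo, ← intervalIntegral.integral_of_le (by linarith),
    ← intervalIntegral.integral_const_mul]
  have := intervalIntegral.integral_comp_add_right (a := 0) (b := 1)
    (fun t : ℝ => Complex.exp (2 * Real.pi * Complex.I * ξ i * t)) (b i : ℝ)
  rw [zero_add, add_comm 1] at this
  rw [← this]
  refine intervalIntegral.integral_congr fun t _ => ?_
  simp only [intVec_apply]
  rw [← Complex.exp_add]
  push_cast; ring_nf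

/-- Separates the arithmetic of `A` from a factor common to all unions of unit cubes. -/
theorem setTransform_iUnion_unitCube (A : Finset (Fin d → ℤ)) (ξ : EuclideanSpace ℝ (Fin d)) :
    setTransform (⋃ b ∈ A, unitCube b) ξ
      = (∑ b ∈ A, character ξ (intVec b)) * cubeFactor ξ := by
  rw [setTransform, integral_biUnion_finset A (fun b _ => (isOpen_unitCube b).measurableSet)
    (pairwiseDisjoint_unitCube A), Finset.sum_mul]
  · exact Finset.sum_congr rfl fun b _ => setTransform_unitCube b ξ
  · intro b _
    have : IsFiniteMeasure (volume.restrict (unitCube b)) := ⟨by simp [volume_unitCube]⟩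
    exact Integrable.of_bound (continuous_character ξ).aestronglyMeasurable 1
      (Filter.Eventually.of_forall fun x => (norm_character ξ x).le)

theorem exp_two_pi_mul_ne_one {θ : ℝ} (h0 : θ ≠ 0) (h1 : |θ| < 1) :
    Complex.exp (2 * Real.pi * Complex.I * θ) ≠ 1 := by
  intro h
  obtain ⟨n, hn⟩ := Complex.exp_eq_one_iff.1 h
  have h2 : (θ : ℂ) = n := by
    have h3 : (2 * Real.pi * Complex.I : ℂ) ≠ 0 := Complex.two_pi_I_ne_zero
    refine mul_left_cancel₀ h3 ?_
    rw [hn]; ring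
  have h3 : θ = n := by exact_mod_cast h2
  rw [h3] at h0 h1
  have h4 : |n| < 1 := by exact_mod_cast h1
  exact h0 (by rw [Int.abs_lt_one_iff.1 h4]; simp)

/-- Each one-dimensional factor vanishes only at nonzero integers. -/
theorem cubeFactor_ne_zero {ξ : EuclideanSpace ℝ (Fin d)} (h : ∀ i, |ξ i| < 1) :
    cubeFactor ξ ≠ 0 := by
  refine Finset.prod_ne_zero_iff.2 fun i _ => ?_
  by_cases h0 : ξ i = 0
  · simp [h0]
  · have hc : (2 * Real.pi * Complex.I * ξ i : ℂ) ≠ 0 :=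
      mul_ne_zero Complex.two_pi_I_ne_zero (by exact_mod_cast h0)
    rw [integral_exp_mul_complex hc]
    refine div_ne_zero ?_ hc
    have := exp_two_pi_mul_ne_one h0 (h i)
    simpa [sub_eq_zero] using this

end Cubes
end Fuglede

end

noncomputable section

namespace Fuglede

/-! ### The finite tile in (ℤ/600)³ and its character sums -/

section FiniteTile

/-- Six vectors whose dilates by `25` tile `(ℤ/600)³`. -/
def shifts : Fin 6 → Fin 3 → ℤ :=
  ![![0, 0, 0], ![12, 18, 22], ![10, 4, 3], ![22, 17, 20], ![14, 13, 2], ![2, 14, 7]]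

/-- A six-element subset of `(ℤ/8)³` which cannot tile, because `6` does not divide `8³`. -/
def packer : Fin 6 → Fin 3 → ZMod 8 :=
  ![![0, 0, 0], ![1, 0, 0], ![0, 1, 0], ![0, 0, 1], ![1, 0, 7], ![1, 7, 0]]

/-- The differences of `packer`, up to sign. -/
def freq : Fin 9 → Fin 3 → ZMod 8 :=
  ![![1, 0, 0], ![0, 1, 0], ![0, 0, 1], ![1, 0, 7], ![1, 7, 0], ![0, 1, 7], ![7, 1, 1],
    ![7, 2, 0], ![7, 0, 2]]

/-- Functionals modulo `3` separating the antipodal pairs that `freq` produces on `shifts`. -/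
def pairing : Fin 9 → Fin 3 → ZMod 3 :=
  ![![0, 1, 0], ![0, 0, 1], ![0, 1, 2], ![1, 0, 2], ![1, 1, 2], ![1, 0, 0], ![0, 1, 0],
    ![0, 1, 2], ![0, 0, 1]]

/-- Reduction from `ℤ/600` to `ℤ/8`. -/
def toZMod8 : ZMod 600 →+* ZMod 8 := ZMod.castHom (by norm_num) _

/-- Reduction from `ℤ/600` to `ℤ/3`. -/
def toZMod3 : ZMod 600 →+* ZMod 3 := ZMod.castHom (by norm_num) _

/-- Reduction from `ℤ/600` to `ℤ/25`. -/
def toZMod25 : ZMod 600 →+* ZMod 25 := ZMod.castHom (by norm_num) _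

/-- The layer of a point, which depends only on its first coordinate modulo `25`. -/
def layer (x : Fin 3 → ZMod 600) : Fin 9 := Fin.ofNat 9 (toZMod25 (x 0)).val

/-- The pairing of a vector modulo `8` with a point of `(ℤ/600)³`. -/
def dot8 (w : Fin 3 → ZMod 8) (x : Fin 3 → ZMod 600) : ZMod 8 := ∑ i, w i * toZMod8 (x i)

/-- The pairing of a vector modulo `3` with a point of `(ℤ/600)³`. -/
def dot3 (w : Fin 3 → ZMod 3) (x : Fin 3 → ZMod 600) : ZMod 3 := ∑ i, w i * toZMod3 (x i)

/-- A subset of `(ℤ/600)³` which, in each layer, is a union of cosets of the joint kernel of a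
functional modulo `8` and a functional modulo `3`. -/
def layered : Finset (Fin 3 → ZMod 600) :=
  Finset.univ.filter fun x =>
    dot3 (pairing (layer x)) x = 0 ∧ (dot8 (freq (layer x)) x).val < 4

theorem mem_layered {x : Fin 3 → ZMod 600} : x ∈ layered ↔
    dot3 (pairing (layer x)) x = 0 ∧ (dot8 (freq (layer x)) x).val < 4 := by
  simp [layered]

attribute [irreducible] layered

/-- The dilates of `shifts`, modulo `600`. -/
def shiftMod (s : Fin 6) : Fin 3 → ZMod 600 := fun i => ((25 * shifts s i : ℤ) : ZMod 600)

theorem layer_sub_shiftMod (y : Fin 3 → ZMod 600) (s : Fin 6) :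
    layer (y - shiftMod s) = layer y := by
  have h : toZMod25 (shiftMod s 0) = 0 := by
    rw [shiftMod, map_intCast]
    push_cast
    rw [show (25 : ZMod 25) = 0 from by decide, zero_mul]
  simp [layer, h]

theorem dot8_sub_shiftMod (w : Fin 3 → ZMod 8) (y : Fin 3 → ZMod 600) (s : Fin 6) :
    dot8 w (y - shiftMod s) = dot8 w y - ∑ i, w i * (shifts s i : ZMod 8) := by
  rw [dot8, dot8, ← Finset.sum_sub_distrib]
  refine Finset.sum_congr rfl fun i _ => ?_
  rw [Pi.sub_apply, map_sub, shiftMod, map_intCast]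
  push_cast
  rw [show (25 : ZMod 8) = 1 from by decide, one_mul, mul_sub]

theorem dot3_sub_shiftMod (w : Fin 3 → ZMod 3) (y : Fin 3 → ZMod 600) (s : Fin 6) :
    dot3 w (y - shiftMod s) = dot3 w y - ∑ i, w i * (shifts s i : ZMod 3) := by
  rw [dot3, dot3, ← Finset.sum_sub_distrib]
  refine Finset.sum_congr rfl fun i _ => ?_
  rw [Pi.sub_apply, map_sub, shiftMod, map_intCast]
  push_cast
  rw [show (25 : ZMod 3) = 1 from by decide, one_mul, mul_sub]

/-- In each layer the functional modulo 3 takes every value on exactly two shifts, and the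
functional modulo 8 sends these two to antipodal points `a`, `a + 4`; the translates of {0, 1, 2, 3}
by such a pair partition ℤ/8. The statement is a finite check. -/
theorem existsUnique_shift (j : Fin 9) (t : ZMod 3) (u : ZMod 8) :
    ∃! s : Fin 6, t - ∑ i, pairing j i * (shifts s i : ZMod 3) = 0 ∧
      (u - ∑ i, freq j i * (shifts s i : ZMod 8)).val < 4 := by
  have h : ∀ (j : Fin 9) (t : ZMod 3) (u : ZMod 8), ∃ s : Fin 6,
      (t - ∑ i, pairing j i * (shifts s i : ZMod 3) = 0 ∧
        (u - ∑ i, freq j i * (shifts s i : ZMod 8)).val < 4) ∧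
      ∀ s' : Fin 6, (t - ∑ i, pairing j i * (shifts s' i : ZMod 3) = 0 ∧
        (u - ∑ i, freq j i * (shifts s' i : ZMod 8)).val < 4) → s' = s := by
    decide +kernel
  exact h j t u

/-- The factor 25 in `shiftMod` preserves layers and is 1 modulo 8 and modulo 3, so the problem
reduces to one layer and two residues. -/
theorem existsUnique_sub_shiftMod_mem (y : Fin 3 → ZMod 600) :
    ∃! s : Fin 6, y - shiftMod s ∈ layered := by
  simp only [mem_layered, layer_sub_shiftMod, dot8_sub_shiftMod, dot3_sub_shiftMod]
  exact existsUnique_shift _ _ _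

theorem card_mul_card_of_existsUnique_sub_mem {G ι : Type*} [AddCommGroup G] [Fintype G]
    [Fintype ι] {A : Finset G} {f : ι → G} (h : ∀ y, ∃! s, y - f s ∈ A) :
    A.card * Fintype.card ι = Fintype.card G := by
  rw [← Finset.card_univ, ← Finset.card_univ, ← Finset.card_product]
  refine Finset.card_bij (fun p _ => p.1 + f p.2) (fun _ _ => Finset.mem_univ _) ?_ ?_
  · rintro ⟨g, s⟩ hg ⟨g', s'⟩ hg' heq
    simp only [Finset.mem_product, Finset.mem_univ, and_true] at hg hg' heq
    have hs : s = s' := (h (g + f s)).unique (by simpa using hg) (by rw [heq]; simpa using hg')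
    subst hs
    simpa using heq
  · intro y _
    obtain ⟨s, hs, -⟩ := h y
    exact ⟨(y - f s, s), by simpa using hs, by simp⟩

theorem card_layered : layered.card = 36000000 := by
  have h := card_mul_card_of_existsUnique_sub_mem existsUnique_sub_shiftMod_mem
  rw [Fintype.card_fun, ZMod.card, Fintype.card_fin, Fintype.card_fin] at h
  norm_num at h
  omega

/-- The Fourier transform of `layered` at the characters of order dividing `8`. -/
def layeredTransform (w : Fin 3 → ZMod 8) : ℂ :=
  ∑ x ∈ layered, ZMod.stdAddChar (dot8 w x)

/-- The points of layer `j` in the kernel of the functional modulo `3`. -/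
def layerKernel (j : Fin 9) : Finset (Fin 3 → ZMod 600) :=
  Finset.univ.filter fun x => layer x = j ∧ dot3 (pairing j) x = 0

theorem mem_layerKernel {j : Fin 9} {x : Fin 3 → ZMod 600} :
    x ∈ layerKernel j ↔ layer x = j ∧ dot3 (pairing j) x = 0 := by
  simp [layerKernel]

attribute [irreducible] layerKernel

theorem dot8_add_left (v w : Fin 3 → ZMod 8) (x : Fin 3 → ZMod 600) :
    dot8 (v + w) x = dot8 v x + dot8 w x := by
  simp [dot8, add_mul, Finset.sum_add_distrib]

theorem dot8_smul_left (c : ZMod 8) (w : Fin 3 → ZMod 8) (x : Fin 3 → ZMod 600) :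
    dot8 (c • w) x = c * dot8 w x := by
  simp [dot8, Finset.mul_sum, mul_assoc]

theorem dot8_add_right (w : Fin 3 → ZMod 8) (x y : Fin 3 → ZMod 600) :
    dot8 w (x + y) = dot8 w x + dot8 w y := by
  simp [dot8, mul_add, Finset.sum_add_distrib]

theorem dot3_add_right (w : Fin 3 → ZMod 3) (x y : Fin 3 → ZMod 600) :
    dot3 w (x + y) = dot3 w x + dot3 w y := by
  simp [dot3, mul_add, Finset.sum_add_distrib]

theorem layerKernel_nonempty (j : Fin 9) : (layerKernel j).Nonempty := by
  have hm : ∀ x, (layer x = j ∧ dot3 (pairing j) x = 0) → (layerKernel j).Nonempty :=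
    fun x hx => ⟨x, mem_layerKernel.2 hx⟩
  -- 576 is 1 modulo 25 and 0 modulo 3: it sets the layer without disturbing the functional modulo
  -- 3.
  refine hm (fun i => if i = 0 then 576 * (j.val : ZMod 600) else 0) ⟨?_, ?_⟩
  · simp only [layer, if_true, map_mul, map_natCast, map_ofNat]
    rw [show (576 : ZMod 25) = 1 from rfl, one_mul]
    clear hm
    revert j
    decide
  · refine Finset.sum_eq_zero fun i _ => ?_
    have h3 : (576 : ZMod 3) = 0 := rfl
    dsimp only
    split_ifs
    · rw [map_mul, map_ofNat, h3, zero_mul, mul_zero]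
    · rw [map_zero, mul_zero]

/-- 225 is 0 modulo 75 and 1 modulo 8, so the residues modulo 8 move freely inside a layer kernel.
-/
theorem add_single_mem_layerKernel {j : Fin 9} {x : Fin 3 → ZMod 600} (k : Fin 3) :
    x + Pi.single k 225 ∈ layerKernel j ↔ x ∈ layerKernel j := by
  have h25 : ∀ i, toZMod25 ((Pi.single k 225 : Fin 3 → ZMod 600) i) = 0 := by
    intro i
    by_cases h : i = k
    · subst h; rw [Pi.single_eq_same, map_ofNat]; rfl
    · simp [h]
  have h3 : ∀ i, toZMod3 ((Pi.single k 225 : Fin 3 → ZMod 600) i) = 0 := by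
    intro i
    by_cases h : i = k
    · subst h; rw [Pi.single_eq_same, map_ofNat]; rfl
    · simp [h]
  have hd : dot3 (pairing j) (Pi.single k 225) = 0 :=
    Finset.sum_eq_zero fun i _ => by rw [h3, mul_zero]
  rw [mem_layerKernel, mem_layerKernel, dot3_add_right, hd, add_zero, layer, layer, Pi.add_apply,
    map_add, h25, add_zero]

/-- Orthogonality: translating by 225 in a coordinate where `w` is nonzero preserves the kernel and
multiplies the sum by a number other than 1. -/
theorem sum_layerKernel (j : Fin 9) (w : Fin 3 → ZMod 8) :
    ∑ x ∈ layerKernel j, ZMod.stdAddChar (dot8 w x)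
      = if w = 0 then ((layerKernel j).card : ℂ) else 0 := by
  split_ifs with hw
  · have h0 : ∀ x, (ZMod.stdAddChar (dot8 0 x) : ℂ) = 1 := fun x => by simp [dot8]
    rw [hw]
    simp_rw [h0]
    rw [Finset.sum_const, nsmul_one]
  · obtain ⟨k, hk⟩ := Function.ne_iff.1 hw
    have h1 : dot8 w (Pi.single k 225) = w k := by
      rw [dot8, Finset.sum_eq_single k]
      · rw [Pi.single_eq_same, show toZMod8 225 = 1 from (map_ofNat _ _).trans rfl, mul_one]
      · intro i _ hi; simp [hi]
      · simp
    have h2 : ∑ x ∈ layerKernel j, (ZMod.stdAddChar (dot8 w x) : ℂ)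
        = ∑ x ∈ layerKernel j, (ZMod.stdAddChar (dot8 w (x + Pi.single k 225)) : ℂ) := by
      refine (Finset.sum_equiv (Equiv.addRight (Pi.single k 225)) ?_ ?_).symm
      · intro x; exact (add_single_mem_layerKernel k).symm
      · intro x _; rfl
    simp_rw [dot8_add_right, h1, AddChar.map_add_eq_mul] at h2
    rw [← Finset.sum_mul] at h2
    have h3 : (ZMod.stdAddChar (w k) : ℂ) ≠ 1 := by
      intro h
      exact hk (ZMod.injective_stdAddChar (h.trans (AddChar.map_zero_eq_one _).symm))
    by_contra hne
    exact h3 (mul_left_cancel₀ hne (by rw [← h2, mul_one]))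

theorem stdAddChar_half : (ZMod.stdAddChar (4 : ZMod 8) : ℂ) = -1 := by
  have h := ZMod.stdAddChar_coe (N := 8) 4
  have e : (2 * Real.pi * Complex.I * ((4 : ℤ) : ℂ) / ((8 : ℕ) : ℂ)) = Real.pi * Complex.I := by
    push_cast; ring
  rw [e, Complex.exp_pi_mul_I] at h
  exact_mod_cast h

/-- Fourier expansion of the symmetrisation of the indicator function of `{0, 1, 2, 3}`. -/
theorem indicator_add_indicator_neg (v : ZMod 8) :
    ((if v.val < 4 then 1 else 0) + (if (-v).val < 4 then 1 else 0) : ℂ)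
      = 1 + (1 / 4) * (ZMod.stdAddChar v + ZMod.stdAddChar (3 * v) + ZMod.stdAddChar (5 * v)
        + ZMod.stdAddChar (7 * v)) := by
  set z : ℂ := ZMod.stdAddChar (1 : ZMod 8) with hz
  have hpow : ∀ n : ℕ, (ZMod.stdAddChar (n : ZMod 8) : ℂ) = z ^ n := by
    intro n
    rw [hz, ← AddChar.map_nsmul_eq_pow, nsmul_one]
  have h4 : z ^ 4 = -1 := by
    rw [← hpow, ← stdAddChar_half]; rfl
  have hval : ∀ u : ZMod 8, (ZMod.stdAddChar u : ℂ) = z ^ u.val := by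
    intro u
    rw [← hpow, ZMod.natCast_zmod_val]
  simp only [hval]
  -- As z⁴ = -1, the four characters add up to 4 at v = 0, to -4 at v = 4 and to 0 elsewhere.
  have e0 : z ^ 5 = -z := by rw [pow_succ, h4]; ring
  have e1 : z ^ 6 = -z ^ 2 := by rw [show z ^ 6 = z ^ 4 * z ^ 2 by ring, h4]; ring
  have e2 : z ^ 7 = -z ^ 3 := by rw [show z ^ 7 = z ^ 4 * z ^ 3 by ring, h4]; ring
  have vals : ∀ u : ZMod 8, u = 0 ∨ u = 1 ∨ u = 2 ∨ u = 3 ∨ u = 4 ∨ u = 5 ∨ u = 6 ∨ u = 7 := by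
    decide
  have v0 : (0 : ZMod 8).val = 0 := rfl
  have v1 : (1 : ZMod 8).val = 1 := rfl
  have v2 : (2 : ZMod 8).val = 2 := rfl
  have v3 : (3 : ZMod 8).val = 3 := rfl
  have v4 : (4 : ZMod 8).val = 4 := rfl
  have v5 : (5 : ZMod 8).val = 5 := rfl
  have v6 : (6 : ZMod 8).val = 6 := rfl
  have v7 : (7 : ZMod 8).val = 7 := rfl
  rcases vals v with h | h | h | h | h | h | h | h <;> subst h
  · norm_num [v0]
  · rw [show -(1 : ZMod 8) = 7 by decide, show (3 : ZMod 8) * 1 = 3 by decide,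
      show (5 : ZMod 8) * 1 = 5 by decide, show (7 : ZMod 8) * 1 = 7 by decide, v1, v3, v5, v7,
      e0, e2]
    norm_num
  · rw [show -(2 : ZMod 8) = 6 by decide, show (3 : ZMod 8) * 2 = 6 by decide,
      show (5 : ZMod 8) * 2 = 2 by decide, show (7 : ZMod 8) * 2 = 6 by decide, v2, v6, e1]
    norm_num
  · rw [show -(3 : ZMod 8) = 5 by decide, show (3 : ZMod 8) * 3 = 1 by decide,
      show (5 : ZMod 8) * 3 = 7 by decide, show (7 : ZMod 8) * 3 = 5 by decide, v1, v3, v5, v7,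
      e0, e2]
    norm_num
  · rw [show -(4 : ZMod 8) = 4 by decide, show (3 : ZMod 8) * 4 = 4 by decide,
      show (5 : ZMod 8) * 4 = 4 by decide, show (7 : ZMod 8) * 4 = 4 by decide, v4, h4]
    norm_num
  · rw [show -(5 : ZMod 8) = 3 by decide, show (3 : ZMod 8) * 5 = 7 by decide,
      show (5 : ZMod 8) * 5 = 1 by decide, show (7 : ZMod 8) * 5 = 3 by decide, v1, v3, v5, v7,
      e0, e2]
    norm_num
  · rw [show -(6 : ZMod 8) = 2 by decide, show (3 : ZMod 8) * 6 = 2 by decide,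
      show (5 : ZMod 8) * 6 = 6 by decide, show (7 : ZMod 8) * 6 = 2 by decide, v2, v6, e1]
    norm_num
  · rw [show -(7 : ZMod 8) = 1 by decide, show (3 : ZMod 8) * 7 = 5 by decide,
      show (5 : ZMod 8) * 7 = 3 by decide, show (7 : ZMod 8) * 7 = 1 by decide, v1, v3, v5, v7,
      e0, e2]
    norm_num

end FiniteTile
end Fuglede

end

noncomputable section

namespace Fuglede

/-! ### Nonvanishing of the finite transform and the packing bound -/

section FiniteTransform

/-- The involution of `(ℤ/600)³` which is `-1` modulo `8` and the identity modulo `75`. -/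
def reflect (x : Fin 3 → ZMod 600) : Fin 3 → ZMod 600 := fun i => 151 * x i

theorem reflect_reflect (x : Fin 3 → ZMod 600) : reflect (reflect x) = x := by
  funext i
  have h : (151 * 151 : ZMod 600) = 1 := rfl
  rw [reflect, reflect, ← mul_assoc, h, one_mul]

theorem dot8_reflect (w : Fin 3 → ZMod 8) (x : Fin 3 → ZMod 600) :
    dot8 w (reflect x) = -dot8 w x := by
  have h : (151 : ZMod 8) = -1 := rfl
  rw [dot8, dot8, ← Finset.sum_neg_distrib]
  refine Finset.sum_congr rfl fun i _ => ?_
  rw [reflect, map_mul, map_ofNat, h]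
  ring

theorem reflect_mem_layerKernel {j : Fin 9} {x : Fin 3 → ZMod 600} :
    reflect x ∈ layerKernel j ↔ x ∈ layerKernel j := by
  have h25 : (151 : ZMod 25) = 1 := rfl
  have h3 : (151 : ZMod 3) = 1 := rfl
  have hl : layer (reflect x) = layer x := by
    rw [layer, layer, reflect, map_mul, map_ofNat, h25, one_mul]
  have hd : dot3 (pairing j) (reflect x) = dot3 (pairing j) x := by
    refine Finset.sum_congr rfl fun i _ => ?_
    rw [reflect, map_mul, map_ofNat, h3, one_mul]
  rw [mem_layerKernel, mem_layerKernel, hl, hd]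

theorem sum_layerKernel_reflect (j : Fin 9) (f : (Fin 3 → ZMod 600) → ℂ) :
    ∑ x ∈ layerKernel j, f (reflect x) = ∑ x ∈ layerKernel j, f x :=
  Finset.sum_equiv (Function.Involutive.toPerm reflect reflect_reflect)
    (fun _ => reflect_mem_layerKernel.symm) fun _ _ => rfl

theorem layeredTransform_eq_sum (w : Fin 3 → ZMod 8) :
    layeredTransform w = ∑ j, ∑ x ∈ layerKernel j,
      (if (dot8 (freq j) x).val < 4 then 1 else 0) * ZMod.stdAddChar (dot8 w x) := by
  rw [layeredTransform, ← Finset.sum_fiberwise layered layer]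
  refine Finset.sum_congr rfl fun j _ => ?_
  have h : layered.filter (fun x => layer x = j)
      = (layerKernel j).filter fun x => (dot8 (freq j) x).val < 4 := by
    refine Finset.ext fun x => ?_
    rw [Finset.mem_filter, Finset.mem_filter, mem_layered, mem_layerKernel]
    constructor
    · rintro ⟨⟨h1, h2⟩, rfl⟩; exact ⟨⟨rfl, h1⟩, h2⟩
    · rintro ⟨⟨rfl, h1⟩, h2⟩; exact ⟨⟨h1, h2⟩, rfl⟩
  rw [h, Finset.sum_filter]
  simp only [ite_mul, one_mul, zero_mul]

theorem conj_layeredTransform (w : Fin 3 → ZMod 8) :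
    (starRingEnd ℂ) (layeredTransform w) = ∑ j, ∑ x ∈ layerKernel j,
      (if (-dot8 (freq j) x).val < 4 then 1 else 0) * ZMod.stdAddChar (dot8 w x) := by
  rw [layeredTransform_eq_sum, map_sum]
  refine Finset.sum_congr rfl fun j _ => ?_
  rw [map_sum, ← sum_layerKernel_reflect]
  refine Finset.sum_congr rfl fun x _ => ?_
  rw [map_mul, dot8_reflect, dot8_reflect, AddChar.map_neg_eq_conj, Complex.conj_conj]
  split_ifs <;> simp

/-- Conjugation amounts to `reflect`, which symmetrises the half-interval {0, 1, 2, 3} in each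
layer. All Fourier coefficients of the symmetrised indicator are nonnegative, so twice the real part
is a nonnegative combination of kernel sums. -/
theorem layeredTransform_add_conj (w : Fin 3 → ZMod 8) :
    layeredTransform w + (starRingEnd ℂ) (layeredTransform w)
      = ∑ j, (∑ x ∈ layerKernel j, ZMod.stdAddChar (dot8 w x)
        + (1 / 4) * (∑ x ∈ layerKernel j, ZMod.stdAddChar (dot8 (w + freq j) x)
          + ∑ x ∈ layerKernel j, ZMod.stdAddChar (dot8 (w + (3 : ZMod 8) • freq j) x)
          + ∑ x ∈ layerKernel j, ZMod.stdAddChar (dot8 (w + (5 : ZMod 8) • freq j) x)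
          + ∑ x ∈ layerKernel j, ZMod.stdAddChar (dot8 (w + (7 : ZMod 8) • freq j) x))) := by
  rw [conj_layeredTransform, layeredTransform_eq_sum, ← Finset.sum_add_distrib]
  refine Finset.sum_congr rfl fun j _ => ?_
  rw [← Finset.sum_add_distrib, ← Finset.sum_add_distrib, ← Finset.sum_add_distrib,
    ← Finset.sum_add_distrib, Finset.mul_sum, ← Finset.sum_add_distrib]
  refine Finset.sum_congr rfl fun x _ => ?_
  rw [← add_mul, indicator_add_indicator_neg]
  simp only [dot8_add_left, dot8_smul_left, AddChar.map_add_eq_mul]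
  ring

theorem sum_layerKernel_re_nonneg (j : Fin 9) (w : Fin 3 → ZMod 8) :
    0 ≤ (∑ x ∈ layerKernel j, (ZMod.stdAddChar (dot8 w x) : ℂ)).re := by
  rw [sum_layerKernel]; split_ifs <;> simp

theorem sum_layerKernel_re_pos (j : Fin 9) {w : Fin 3 → ZMod 8} (hw : w = 0) :
    0 < (∑ x ∈ layerKernel j, (ZMod.stdAddChar (dot8 w x) : ℂ)).re := by
  rw [sum_layerKernel, if_pos hw, Complex.natCast_re, Nat.cast_pos, Finset.card_pos]
  exact layerKernel_nonempty j

/-- The real part is a sum of nonnegative terms, so one positive term suffices: the constant term if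
`w = 0`, and for `w = ±freq j` the term of layer `j` whose frequency `w + 7 • freq j` or `w + freq
j` is 0. -/
theorem layeredTransform_ne_zero {w : Fin 3 → ZMod 8}
    (hw : w = 0 ∨ ∃ j, w = freq j ∨ w = -freq j) : layeredTransform w ≠ 0 := by
  intro h0
  have h := congrArg Complex.re (layeredTransform_add_conj w)
  rw [h0, map_zero, add_zero, Complex.zero_re, Complex.re_sum] at h
  have hre : ∀ j, (∑ x ∈ layerKernel j, (ZMod.stdAddChar (dot8 w x) : ℂ)
        + (1 / 4) * (∑ x ∈ layerKernel j, ZMod.stdAddChar (dot8 (w + freq j) x)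
          + ∑ x ∈ layerKernel j, ZMod.stdAddChar (dot8 (w + (3 : ZMod 8) • freq j) x)
          + ∑ x ∈ layerKernel j, ZMod.stdAddChar (dot8 (w + (5 : ZMod 8) • freq j) x)
          + ∑ x ∈ layerKernel j, ZMod.stdAddChar (dot8 (w + (7 : ZMod 8) • freq j) x))).re
      = (∑ x ∈ layerKernel j, (ZMod.stdAddChar (dot8 w x) : ℂ)).re
        + (1 / 4) * ((∑ x ∈ layerKernel j, (ZMod.stdAddChar (dot8 (w + freq j) x) : ℂ)).re
          + (∑ x ∈ layerKernel j,
              (ZMod.stdAddChar (dot8 (w + (3 : ZMod 8) • freq j) x) : ℂ)).re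
          + (∑ x ∈ layerKernel j,
              (ZMod.stdAddChar (dot8 (w + (5 : ZMod 8) • freq j) x) : ℂ)).re
          + (∑ x ∈ layerKernel j,
              (ZMod.stdAddChar (dot8 (w + (7 : ZMod 8) • freq j) x) : ℂ)).re) := by
    intro j
    have e : (1 / 4 : ℂ) = ((1 / 4 : ℝ) : ℂ) := by push_cast; rfl
    rw [e, Complex.add_re, Complex.re_ofReal_mul, Complex.add_re, Complex.add_re, Complex.add_re]
  simp only [hre] at h
  have hn := fun j => sum_layerKernel_re_nonneg j w
  have hn1 := fun j => sum_layerKernel_re_nonneg j (w + freq j)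
  have hn3 := fun j => sum_layerKernel_re_nonneg j (w + (3 : ZMod 8) • freq j)
  have hn5 := fun j => sum_layerKernel_re_nonneg j (w + (5 : ZMod 8) • freq j)
  have hn7 := fun j => sum_layerKernel_re_nonneg j (w + (7 : ZMod 8) • freq j)
  have hz := (Finset.sum_eq_zero_iff_of_nonneg fun j _ => by
    linarith [hn j, hn1 j, hn3 j, hn5 j, hn7 j]).1 h.symm
  rcases hw with hw | ⟨j, hw | hw⟩
  · have := hz 0 (Finset.mem_univ _)
    linarith [sum_layerKernel_re_pos 0 hw, hn1 0, hn3 0, hn5 0, hn7 0]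
  · have h7 : w + (7 : ZMod 8) • freq j = 0 := by
      have e : (7 : ZMod 8) = -1 := rfl
      rw [hw, e, neg_one_smul, add_neg_cancel]
    have := hz j (Finset.mem_univ _)
    linarith [sum_layerKernel_re_pos j h7, hn j, hn1 j, hn3 j, hn5 j]
  · have h1 : w + freq j = 0 := by rw [hw, neg_add_cancel]
    have := hz j (Finset.mem_univ _)
    linarith [sum_layerKernel_re_pos j h1, hn j, hn3 j, hn5 j, hn7 j]

theorem packer_sub (k l : Fin 6) :
    packer l - packer k = 0 ∨ ∃ j, packer l - packer k = freq j ∨ packer l - packer k = -freq j := by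
  revert k l
  decide +kernel

theorem packer_injective : Function.Injective packer := by
  decide +kernel

/-- A set of frequencies whose differences are zeros of the transform of `layered` is packed by
`packer`, so has fewer than `8³ / 6` elements. -/
theorem card_le_of_layeredTransform_eq_zero {I : Finset (Fin 3 → ZMod 8)}
    (hI : ∀ a ∈ I, ∀ b ∈ I, a ≠ b → layeredTransform (a - b) = 0) : I.card ≤ 85 := by
  have hinj : Set.InjOn (fun p : (Fin 3 → ZMod 8) × Fin 6 => p.1 + packer p.2)
      (I ×ˢ (Finset.univ : Finset (Fin 6)) : Finset _) := by
    rintro ⟨a, k⟩ ha ⟨b, l⟩ hb h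
    simp only [Finset.coe_product, Set.mem_prod, Finset.mem_coe, Finset.mem_univ, and_true]
      at ha hb h
    have hab : a - b = packer l - packer k := by
      -- Overlapping translates of `packer` make `a - b` a difference of `packer`, where the
      -- transform does not vanish; this forces `a = b`.
      rw [sub_eq_sub_iff_add_eq_add, h, add_comm]
    have hab' : a = b := by
      by_contra hne
      exact layeredTransform_ne_zero (hab ▸ packer_sub k l) (hI a ha b hb hne)
    subst hab'
    rw [packer_injective (add_left_cancel h)]
  have h := Finset.card_le_card_of_injOn _ (fun _ _ => Finset.mem_coe.2 (Finset.mem_univ _)) hinj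
  rw [Finset.card_product, Finset.card_univ, Finset.card_univ, Fintype.card_fun, ZMod.card,
    Fintype.card_fin, Fintype.card_fin] at h
  omega

end FiniteTransform
end Fuglede

end

noncomputable section

namespace Fuglede

open scoped ENNReal

/-! ### Repeating the finite tile over a large box -/

section Periodization

/-- The integer points of the box `[0, 600 L)³` whose class modulo `600` lies in `layered`. -/
def boxed (L : ℕ) : Finset (Fin 3 → ℤ) :=
  (Fintype.piFinset fun _ => Finset.Ico (0 : ℤ) (600 * L)).filter
    fun x => (fun i => (x i : ZMod 600)) ∈ layered

theorem mem_boxed {L : ℕ} {x : Fin 3 → ℤ} : x ∈ boxed L ↔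
    (∀ i, 0 ≤ x i ∧ x i < 600 * L) ∧ (fun i => (x i : ZMod 600)) ∈ layered := by
  simp [boxed]

/-- The point of `boxed L` with class `g` modulo `600` in the `m`-th period. -/
def boxPoint (g : Fin 3 → ZMod 600) (m : Fin 3 → ℕ) : Fin 3 → ℤ :=
  fun i => (g i).val + 600 * m i

theorem sum_boxed (L : ℕ) (F : (Fin 3 → ℤ) → ℂ) :
    ∑ x ∈ boxed L, F x
      = ∑ p ∈ layered ×ˢ Fintype.piFinset fun _ : Fin 3 => Finset.range L,
        F (boxPoint p.1 p.2) := by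
  have hcast : ∀ g m, (fun i => ((boxPoint g m i : ℤ) : ZMod 600)) = g := by
    intro g m
    funext i
    have h : (600 : ZMod 600) = 0 := rfl
    simp only [boxPoint]
    push_cast
    rw [h, zero_mul, add_zero, ZMod.natCast_zmod_val]
  symm
  refine Finset.sum_nbij' (fun p => boxPoint p.1 p.2)
    (fun x => (fun i => (x i : ZMod 600), fun i => (x i / 600).toNat)) ?_ ?_ ?_ ?_ ?_
  · rintro ⟨g, m⟩ h
    rw [Finset.mem_product, Fintype.mem_piFinset] at h
    refine mem_boxed.2 ⟨fun i => ?_, by rw [hcast]; exact h.1⟩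
    have h1 := Finset.mem_range.1 (h.2 i)
    have h2 := ZMod.val_lt (g i)
    simp only [boxPoint] at *
    omega
  · intro x hx
    rw [mem_boxed] at hx
    rw [Finset.mem_product, Fintype.mem_piFinset]
    refine ⟨hx.2, fun i => Finset.mem_range.2 ?_⟩
    have := hx.1 i
    simp only
    omega
  · rintro ⟨g, m⟩ h
    refine Prod.ext (hcast g m) (funext fun i => ?_)
    have h2 := ZMod.val_lt (g i)
    simp only [boxPoint]
    omega
  · intro x hx
    rw [mem_boxed] at hx
    funext i
    have h1 := hx.1 i
    have h2 : (((x i : ZMod 600).val : ℕ) : ℤ) = x i % 600 := ZMod.val_intCast _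
    simp only [boxPoint]
    rw [h2]
    omega
  · intro p _; rfl

theorem card_boxed (L : ℕ) : (boxed L).card = 36000000 * L ^ 3 := by
  have h := sum_boxed L fun _ => 1
  rw [Finset.sum_const, Finset.sum_const, Finset.card_product, card_layered,
    Fintype.card_piFinset, Finset.prod_const, Finset.card_univ, Fintype.card_fin,
    Finset.card_range, nsmul_one, nsmul_one] at h
  exact_mod_cast h

/-- The complement is the six vectors `25 * shifts s` plus the lattice 600L·ℤ³. Reduction modulo 600
determines the shift, and division by 600L then determines the lattice vector. -/
theorem isTile_boxed {L : ℕ} (hL : 0 < L) : IsTile (⋃ b ∈ boxed L, unitCube b) := by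
  have hperiod : ∀ n : ℤ, ((600 * L * n : ℤ) : ZMod 600) = 0 := by
    intro n
    have h : (600 : ZMod 600) = 0 := rfl
    push_cast
    rw [h, zero_mul, zero_mul]
  refine isTile_iUnion_unitCube
    (T' := {t | ∃ s : Fin 6, ∃ z : Fin 3 → ℤ, ∀ i, t i = 25 * shifts s i + 600 * L * z i}) ?_ ?_
  · intro y
    obtain ⟨s, hs, -⟩ := existsUnique_sub_shiftMod_mem fun i => (y i : ZMod 600)
    refine ⟨fun i => 25 * shifts s i + 600 * L * ((y i - 25 * shifts s i) / (600 * L)),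
      ⟨s, _, fun i => rfl⟩, fun i => (y i - 25 * shifts s i) % (600 * L),
      mem_boxed.2 ⟨fun i => ?_, ?_⟩, funext fun i => ?_⟩
    · have : (0 : ℤ) < 600 * L := by positivity
      exact ⟨Int.emod_nonneg _ this.ne', Int.emod_lt_of_pos _ this⟩
    · convert hs using 1
      funext i
      rw [Int.emod_def, Int.cast_sub, hperiod, sub_zero, Pi.sub_apply, shiftMod, Int.cast_sub]
    · have := Int.emod_add_mul_ediv (y i - 25 * shifts s i) (600 * L)
      simp only [Pi.add_apply]
      linarith
  · rintro t ⟨s, z, ht⟩ t' ⟨s', z', ht'⟩ a ha b hb h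
    rw [mem_boxed] at ha hb
    have key : ∀ i, 25 * shifts s i + 600 * L * z i + a i
        = 25 * shifts s' i + 600 * L * z' i + b i := by
      intro i
      rw [← ht, ← ht']
      exact congrFun h i
    have hss : s = s' := by
      refine (existsUnique_sub_shiftMod_mem (fun i => ((t i + a i : ℤ) : ZMod 600))).unique ?_ ?_
      · convert ha.2 using 1
        funext i
        rw [Pi.sub_apply, shiftMod, ht]
        rw [← Int.cast_sub, ← sub_eq_zero, ← Int.cast_sub, ← hperiod (z i)]
        congr 1; ring
      · convert hb.2 using 1
        funext i
        rw [Pi.sub_apply, shiftMod, ht, key]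
        rw [← Int.cast_sub, ← sub_eq_zero, ← Int.cast_sub, ← hperiod (z' i)]
        congr 1; ring
    subst hss
    funext i
    have h1 := key i
    have h2 := ha.1 i
    have h3 := hb.1 i
    have hpos : (0 : ℤ) < 600 * L := by positivity
    have h4 : 600 * L * z i + a i = 600 * L * z' i + b i := by linarith
    have h5 := congrArg (· / (600 * L : ℤ)) h4
    simp only [Int.mul_add_ediv_left _ _ hpos.ne', Int.ediv_eq_zero_of_lt h2.1 h2.2,
      Int.ediv_eq_zero_of_lt h3.1 h3.2, add_zero] at h5
    rw [ht, ht', h5]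

/-- The exponential sum of `layered` over its representatives in `[0, 600)³`. -/
def layeredSum (ξ : EuclideanSpace ℝ (Fin 3)) : ℂ :=
  ∑ g ∈ layered, character ξ (intVec fun i => ((g i).val : ℤ))

/-- A point of `boxed L` is a residue representative plus 600 times a period vector, so the sum
factors into one period and a geometric sum per coordinate. -/
theorem sum_character_boxed (L : ℕ) (ξ : EuclideanSpace ℝ (Fin 3)) :
    ∑ b ∈ boxed L, character ξ (intVec b) = layeredSum ξ *
      ∏ i, ∑ m ∈ Finset.range L, Complex.exp (2 * Real.pi * Complex.I * (600 * ξ i : ℝ)) ^ m := by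
  rw [sum_boxed, Finset.sum_product, layeredSum, Finset.sum_mul]
  refine Finset.sum_congr rfl fun g _ => ?_
  rw [Finset.prod_univ_sum, Finset.mul_sum]
  refine Finset.sum_congr rfl fun m _ => ?_
  rw [character_eq_prod, character_eq_prod, ← Finset.prod_mul_distrib]
  refine Finset.prod_congr rfl fun i _ => ?_
  rw [← Complex.exp_nat_mul, ← Complex.exp_add]
  congr 1
  simp only [boxPoint, intVec_apply]
  push_cast; ring

/-- A Dirichlet kernel with `L` terms has no zero at distance less than 1/L from an integer. -/
theorem geom_sum_exp_ne_zero {L : ℕ} (hL : 0 < L) {θ : ℝ} {n : ℤ} (h : |θ - n| * L < 1) :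
    ∑ m ∈ Finset.range L, Complex.exp (2 * Real.pi * Complex.I * θ) ^ m ≠ 0 := by
  have hLR : (0 : ℝ) < L := by exact_mod_cast hL
  have he : Complex.exp (2 * Real.pi * Complex.I * θ)
      = Complex.exp (2 * Real.pi * Complex.I * ((θ - n : ℝ) : ℂ)) := by
    rw [Complex.exp_eq_exp_iff_exists_int]
    exact ⟨n, by push_cast; ring⟩
  rw [he]
  by_cases h0 : θ - n = 0
  · simp [h0, hL.ne']
  · have h1 : |θ - n| < 1 := by
      have : (1 : ℝ) ≤ L := by exact_mod_cast hL
      nlinarith [abs_nonneg (θ - n)]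
    have hne := exp_two_pi_mul_ne_one h0 h1
    rw [geom_sum_eq hne]
    refine div_ne_zero (sub_ne_zero.2 ?_) (sub_ne_zero.2 hne)
    rw [← Complex.exp_nat_mul]
    have e : (L : ℂ) * (2 * Real.pi * Complex.I * ((θ - n : ℝ) : ℂ))
        = 2 * Real.pi * Complex.I * (((θ - n) * L : ℝ) : ℂ) := by push_cast; ring
    rw [e]
    refine exp_two_pi_mul_ne_one (mul_ne_zero h0 hLR.ne') ?_
    rwa [abs_mul, abs_of_pos hLR]

/-- The point `c / 8 + v`. -/
def eighthPoint (c : Fin 3 → ℤ) (v : Fin 3 → ℝ) : EuclideanSpace ℝ (Fin 3) :=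
  WithLp.toLp 2 fun i => (c i : ℝ) / 8 + v i

theorem layeredSum_eighthPoint_zero (c : Fin 3 → ℤ) :
    layeredSum (eighthPoint c 0) = layeredTransform fun i => (c i : ZMod 8) := by
  refine Finset.sum_congr rfl fun g _ => ?_
  have h : dot8 (fun i => (c i : ZMod 8)) g
      = ((∑ i, c i * ((g i).val : ℤ) : ℤ) : ZMod 8) := by
    rw [dot8]
    push_cast
    refine Finset.sum_congr rfl fun i _ => ?_
    rw [← map_natCast toZMod8, ZMod.natCast_zmod_val]
  rw [h, ZMod.stdAddChar_coe, character_eq_prod, ← Complex.exp_sum]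
  congr 1
  push_cast
  rw [Finset.mul_sum, Finset.sum_div]
  refine Finset.sum_congr rfl fun i _ => ?_
  simp only [eighthPoint, intVec_apply, Pi.zero_apply]
  push_cast; ring

theorem continuous_layeredSum : Continuous layeredSum := by
  refine continuous_finsetSum _ fun g _ => ?_
  unfold character; fun_prop

/-- Continuity at finitely many points. The radius depends only on `layered`, not on `L`, so `L` may
be chosen afterwards. -/
theorem exists_layeredSum_ne_zero : ∃ ε > 0, ∀ c : Fin 3 → ℤ, (∀ i, |c i| < 8) →
    layeredTransform (fun i => (c i : ZMod 8)) ≠ 0 →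
    ∀ v : Fin 3 → ℝ, (∀ i, |v i| < ε) → layeredSum (eighthPoint c v) ≠ 0 := by
  have h : ∀ᶠ v : Fin 3 → ℝ in nhds 0,
      ∀ c ∈ Fintype.piFinset fun _ : Fin 3 => Finset.Ioo (-8 : ℤ) 8,
        layeredTransform (fun i => (c i : ZMod 8)) ≠ 0 → layeredSum (eighthPoint c v) ≠ 0 := by
    rw [Filter.eventually_all_finset]
    intro c _
    by_cases hc : layeredTransform (fun i => (c i : ZMod 8)) = 0
    · exact Filter.Eventually.of_forall fun _ h => absurd hc h
    · have hcont : Continuous fun v => layeredSum (eighthPoint c v) :=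
        continuous_layeredSum.comp (by unfold eighthPoint; fun_prop)
      refine (hcont.continuousAt.eventually_ne ?_).mono fun v hv _ => hv
      rwa [layeredSum_eighthPoint_zero]
  obtain ⟨ε, hε, H⟩ := Metric.eventually_nhds_iff.1 h
  refine ⟨ε, hε, fun c hc hw v hv => H ?_ c ?_ hw⟩
  · rw [dist_zero_right, pi_norm_lt_iff hε]
    exact hv
  · rw [Fintype.mem_piFinset]
    exact fun i => Finset.mem_Ioo.2 (abs_lt.1 (hc i))

end Periodization

/-! ### Counting spectrum points in a comb -/

section Spectrum

/-- The points whose coordinates all lie in one of the intervals `[k / 8, k / 8 + δ)`,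
`0 ≤ k < 8`. -/
def combSet (δ : ℝ) : Set (EuclideanSpace ℝ (Fin 3)) :=
  (WithLp.ofLp : EuclideanSpace ℝ (Fin 3) → Fin 3 → ℝ) ⁻¹'
    Set.univ.pi fun _ => ⋃ k ∈ Finset.range 8, Set.Ico ((k : ℝ) / 8) ((k : ℝ) / 8 + δ)

theorem measurableSet_comb (δ : ℝ) : MeasurableSet
    (⋃ k ∈ Finset.range 8, Set.Ico ((k : ℝ) / 8) ((k : ℝ) / 8 + δ)) :=
  Finset.measurableSet_biUnion _ fun _ _ => measurableSet_Ico

theorem measurableSet_combSet (δ : ℝ) : MeasurableSet (combSet δ) :=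
  (PiLp.volume_preserving_ofLp (Fin 3)).measurable
    (MeasurableSet.univ_pi fun _ => measurableSet_comb δ)

theorem volume_combSet {δ : ℝ} (h1 : δ ≤ 1 / 8) :
    volume (combSet δ) = (8 * ENNReal.ofReal δ) ^ 3 := by
  rw [combSet, (PiLp.volume_preserving_ofLp (Fin 3)).measure_preimage
    (MeasurableSet.univ_pi fun _ => measurableSet_comb δ).nullMeasurableSet, volume_pi_pi,
    Finset.prod_const, Finset.card_univ, Fintype.card_fin, measure_biUnion_finset]
  · simp
  · intro k _ l _ hkl
    refine Set.disjoint_left.2 fun x hx hy => hkl ?_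
    have h2 : (k : ℝ) < l + 1 := by linarith [hx.1, hy.2]
    have h3 : (l : ℝ) < k + 1 := by linarith [hx.2, hy.1]
    have h4 : k < l + 1 := by exact_mod_cast h2
    have h5 : l < k + 1 := by exact_mod_cast h3
    omega
  · exact fun _ _ => measurableSet_Ico

theorem exists_of_mem_combSet {δ : ℝ} {x : EuclideanSpace ℝ (Fin 3)} (hx : x ∈ combSet δ) :
    ∃ k : Fin 3 → ℤ, ∀ i, 0 ≤ k i ∧ k i < 8 ∧ (k i : ℝ) / 8 ≤ x i ∧ x i < (k i : ℝ) / 8 + δ := by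
  have h : ∀ i, ∃ k : ℤ, 0 ≤ k ∧ k < 8 ∧ (k : ℝ) / 8 ≤ x i ∧ x i < (k : ℝ) / 8 + δ := by
    intro i
    have := hx i (Set.mem_univ i)
    simp only [Set.mem_iUnion, Finset.mem_range, exists_prop] at this
    obtain ⟨k, hk, h1, h2⟩ := this
    exact ⟨k, by positivity, by exact_mod_cast hk, by rwa [Int.cast_natCast],
      by rwa [Int.cast_natCast]⟩
  choose k hk using h
  exact ⟨k, hk⟩

/-- Rounding to the nodes k/8 sends the spectrum points of a translated comb to frequencies modulo
8. If the finite transform were nonzero at a difference of two such frequencies, none of the three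
factors of the transform of the cube union could vanish, against orthogonality; so the packing bound
applies. -/
theorem encard_spectrum_inter_combSet_le {ε : ℝ} (hε : ∀ c : Fin 3 → ℤ, (∀ i, |c i| < 8) →
      layeredTransform (fun i => (c i : ZMod 8)) ≠ 0 →
      ∀ v : Fin 3 → ℝ, (∀ i, |v i| < ε) → layeredSum (eighthPoint c v) ≠ 0)
    {L : ℕ} (hL : 0 < L) (hLε : 1 / (600 * L : ℝ) ≤ ε) {Λ : Set (EuclideanSpace ℝ (Fin 3))}
    (hΛ : IsSpectrum Λ (⋃ b ∈ boxed L, unitCube b)) (u : EuclideanSpace ℝ (Fin 3)) :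
    {ξ ∈ Λ | u + ξ ∈ combSet (1 / (600 * L))}.encard ≤ 85 := by
  classical
  have hLR : (1 : ℝ) ≤ L := by exact_mod_cast hL
  set δ : ℝ := 1 / (600 * L) with hδ
  have hδL : δ * (600 * L) = 1 := by rw [hδ]; field_simp
  have hδ8 : δ ≤ 1 / 8 := by nlinarith
  set P := {ξ ∈ Λ | u + ξ ∈ combSet δ} with hP
  have hex : ∀ ξ, ∃ k : Fin 3 → ℤ, ξ ∈ P → ∀ i,
      0 ≤ k i ∧ k i < 8 ∧ (k i : ℝ) / 8 ≤ (u + ξ) i ∧ (u + ξ) i < (k i : ℝ) / 8 + δ := by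
    intro ξ
    by_cases h : ξ ∈ P
    · obtain ⟨k, hk⟩ := exists_of_mem_combSet h.2
      exact ⟨k, fun _ => hk⟩
    · exact ⟨0, fun h' => absurd h' h⟩
  choose k hk using hex
  have key : ∀ ξ ∈ P, ∀ η ∈ P, ξ ≠ η →
      layeredTransform (fun i => ((k ξ i - k η i : ℤ) : ZMod 8)) = 0 := by
    intro ξ hξ η hη hne
    by_contra hw
    have hz := hΛ.setTransform_eq_zero hξ.1 hη.1 hne
    rw [setTransform_iUnion_unitCube, sum_character_boxed] at hz
    have hv : ∀ i, |ξ i - η i - ((k ξ i - k η i : ℤ) : ℝ) / 8| < δ := by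
      intro i
      obtain ⟨-, -, a1, a2⟩ := hk ξ hξ i
      obtain ⟨-, -, b1, b2⟩ := hk η hη i
      simp only [PiLp.add_apply] at a1 a2 b1 b2
      push_cast
      rw [abs_lt]
      constructor <;> linarith
    have hk8 : ∀ i, |k ξ i - k η i| < 8 := by
      intro i
      obtain ⟨a1, a2, -, -⟩ := hk ξ hξ i
      obtain ⟨b1, b2, -, -⟩ := hk η hη i
      rw [abs_lt]
      omega
    have e : ξ - η = eighthPoint (fun i => k ξ i - k η i)
        fun i => ξ i - η i - ((k ξ i - k η i : ℤ) : ℝ) / 8 := by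
      ext i
      simp [eighthPoint]
    refine mul_ne_zero (mul_ne_zero ?_ ?_) ?_ hz
    · rw [e]
      exact hε _ hk8 hw _ fun i => (hv i).trans_le hLε
    · refine Finset.prod_ne_zero_iff.2 fun i _ => ?_
      -- Since 600/8 = 75, the nodes c/8 become integers after scaling by 600; the error is below
      -- 600δ = 1/L.
      refine geom_sum_exp_ne_zero hL (n := 75 * (k ξ i - k η i)) ?_
      have h1 : 600 * (ξ - η) i - ((75 * (k ξ i - k η i) : ℤ) : ℝ)
          = 600 * (ξ i - η i - ((k ξ i - k η i : ℤ) : ℝ) / 8) := by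
        simp only [PiLp.sub_apply]
        push_cast; ring
      rw [h1, abs_mul, abs_of_pos (by norm_num : (0 : ℝ) < 600)]
      have := hv i
      nlinarith
    -- Both points of the comb have coordinates in [0, 7/8 + δ), and δ ≤ 1/8, so they differ by less
    -- than 1.
    · refine cubeFactor_ne_zero fun i => ?_
      obtain ⟨a0, a1, a2, a3⟩ := hk ξ hξ i
      obtain ⟨b0, b1, b2, b3⟩ := hk η hη i
      have a0' : (0 : ℝ) ≤ k ξ i := by exact_mod_cast a0
      have b0' : (0 : ℝ) ≤ k η i := by exact_mod_cast b0
      have a1' : (k ξ i : ℝ) ≤ 7 := by exact_mod_cast Int.lt_add_one_iff.1 a1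
      have b1' : (k η i : ℝ) ≤ 7 := by exact_mod_cast Int.lt_add_one_iff.1 b1
      simp only [PiLp.add_apply] at a2 a3 b2 b3
      rw [PiLp.sub_apply, abs_lt]
      constructor <;> linarith
  have hzero : layeredTransform 0 ≠ 0 := layeredTransform_ne_zero (Or.inl rfl)
  set f : EuclideanSpace ℝ (Fin 3) → Fin 3 → ZMod 8 := fun ξ i => (k ξ i : ZMod 8) with hf
  have hsub : ∀ ξ ∈ P, ∀ η ∈ P, ξ ≠ η → layeredTransform (f ξ - f η) = 0 := by
    intro ξ hξ η hη hne
    rw [← key ξ hξ η hη hne]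
    congr 1
    funext i
    simp [hf]
  -- Two spectrum points with the same rounding would make the transform vanish at 0.
  have hinj : Set.InjOn f P := by
    intro ξ hξ η hη h
    by_contra hne
    have := hsub ξ hξ η hη hne
    rw [h, sub_self] at this
    exact hzero this
  rw [← hinj.encard_image, ← Set.coe_toFinset (f '' P), Set.encard_coe_eq_coe_finsetCard]
  have := card_le_of_layeredTransform_eq_zero (I := (f '' P).toFinset) ?_
  · exact_mod_cast this
  · intro a ha b hb hab
    rw [Set.mem_toFinset] at ha hb
    obtain ⟨ξ, hξ, rfl⟩ := ha
    obtain ⟨η, hη, rfl⟩ := hb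
    exact hsub ξ hξ η hη fun h => hab (by rw [h])

theorem exists_not_isSpectral_boxed :
    ∃ L : ℕ, 0 < L ∧ ¬ IsSpectral (⋃ b ∈ boxed L, unitCube b) := by
  obtain ⟨ε, hε, H⟩ := exists_layeredSum_ne_zero
  obtain ⟨n, hn⟩ := exists_nat_one_div_lt hε
  refine ⟨n + 1, n.succ_pos, ?_⟩
  rintro ⟨Λ, hΛ⟩
  set L : ℕ := n + 1 with hLdef
  have hL : 0 < L := n.succ_pos
  have hLR : (1 : ℝ) ≤ L := by exact_mod_cast hL
  have hLε : 1 / (600 * L : ℝ) ≤ ε := by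
    refine le_trans ?_ hn.le
    have : ((n : ℝ) + 1) = L := by rw [hLdef]; push_cast; rfl
    rw [this]
    exact one_div_le_one_div_of_le (by linarith) (by linarith)
  have hδ8 : 1 / (600 * L : ℝ) ≤ 1 / 8 :=
    one_div_le_one_div_of_le (by norm_num) (by linarith)
  have hvol := volume_iUnion_unitCube (boxed L)
  rw [card_boxed] at hvol
  have h0 : volume (⋃ b ∈ boxed L, unitCube b) ≠ 0 := by
    rw [hvol]
    exact_mod_cast (by positivity : 36000000 * L ^ 3 ≠ 0)
  have hle := hΛ.volume_mul_volume_le (isOpen_iUnion_unitCube _).measurableSet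
    (by rw [hvol]; exact ENNReal.natCast_ne_top _) h0 (measurableSet_combSet _)
    (c := 85) (encard_spectrum_inter_combSet_le H hL hLε hΛ)
  rw [hvol, volume_combSet hδ8] at hle
  have hr := ENNReal.toReal_mono (by norm_num) hle
  have hpos : (0 : ℝ) ≤ 1 / (600 * L) := by positivity
  rw [ENNReal.toReal_mul, ENNReal.toReal_pow, ENNReal.toReal_mul, ENNReal.toReal_ofReal hpos,
    ENNReal.toReal_natCast, ENNReal.toReal_natCast] at hr
  -- (600³/6)·L³·(8/(600L))³ = 512/6 = 256/3, which exceeds 85 for every `L`.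
  have e : ((36000000 * L ^ 3 : ℕ) : ℝ) * ((8 : ℝ≥0∞).toReal * (1 / (600 * L))) ^ 3
      = 256 / 3 := by
    push_cast
    rw [ENNReal.toReal_ofNat]
    field_simp
    norm_num
  rw [e] at hr
  norm_num at hr

end Spectrum
end Fuglede

end

theorem mainTheorem3 :
    ∃ B : Finset (Fin 3 → ℤ),
      Fuglede.IsTile (⋃ b ∈ B, Fuglede.unitCube b) ∧
      ¬ Fuglede.IsSpectral (⋃ b ∈ B, Fuglede.unitCube b) := by
  obtain ⟨L, hL, h⟩ := Fuglede.exists_not_isSpectral_boxed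
  exact ⟨Fuglede.boxed L, Fuglede.isTile_boxed hL, h⟩
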